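/- All graphs are finite and simple. For a connected graph $G$, an isometric path is a shortest path between its end-vertices, and it is $v$-rooted if $v$ is one of its end-vertices. The strong isometric path complexity of $G$ is the minimum integer $k$ such that, for every vertex $v$ of $G$, the vertices of every isometric path of $G$ can be covered by $k$ $v$-rooted isometric paths. For an integer $K\ge 0$ and a graph $H$, a $K$-fat minor model of $H$ in a graph $G$ is a family $(B_v : v\in V(H))\cup(P_e : e\in E(H))$ of (nonempty) connected subgraphs of $G$ such that $V(B_v)\cap V(P_e)\ne\emptyset$ whenever $v$ is an end-vertex of $e$, and any two members of the family with distinct indices that do not form such an incident pair are at distance at least $K$ in $G$ (no condition if $K=0$; vertices in different components are at infinite distance). If such a model exists, $H$ is a $K$-fat minor of $G$. A class $\mathcal G$ of graphs is $H$-asymptotic minor-free if there is an integer $K\ge 1$ such that no graph in $\mathcal G$ contains $H$ as a $K$-fat minor. Let $U_t$ be the graph obtained from a path with $t$ vertices by adding a vertex adjacent to all of them. Then: 1. There is a function $f\colon\mathbb N\times\mathbb N\to\mathbb N$ such that, for all integers $K\ge 1$ and $t\ge 0$, every connected graph that does not contain $K_{2,t}$ as a $K$-fat minor has strong isometric path complexity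 at most $f(K,t)$. 2. For all integers $K\ge 1$ and $t\ge 1$, every graph that contains $U_t$ as a $K$-fat minor contains $K_{2,t}$ as a $\lfloor K/4\rfloor$-fat minor. 3. For every integer $t\ge 1$, every $K_{2,t}$-asymptotic minor-free class of graphs is $U_t$-asymptotic minor-free. -/

import Mathlib

universe u w

namespace CoarseGraph

/-- An isometric path: a walk whose length is the distance between its end-vertices
(such a walk is automatically a path). -/
def IsIsometric {V : Type u} {G : SimpleGraph V} {x y : V} (p : G.Walk x y) : Prop :=
  p.length = G.dist x y

/-- The vertices of the walk `p` can be covered by `k` isometric paths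
(repetitions allowed) that all have `r` as an end-vertex. -/
def CoveredByRooted {V : Type u} (G : SimpleGraph V) (r : V) (k : ℕ) {x y : V}
    (p : G.Walk x y) : Prop :=
  ∃ (z : Fin k → V) (q : (i : Fin k) → G.Walk r (z i)),
    (∀ i, IsIsometric (q i)) ∧ ∀ a ∈ p.support, ∃ i, a ∈ (q i).support

/-- The strong isometric path complexity: the least `k` such that, for every vertex `r`, the
vertices of every isometric path can be covered by `k` isometric paths rooted at `r`
(`⊤` if there is no such `k`, which cannot happen for a finite connected graph). -/
noncomputable def strongIsometricPathComplexity {V : Type u} (G : SimpleGraph V) : ℕ∞ :=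
  ⨅ k ∈ {k : ℕ | ∀ (r x y : V) (p : G.Walk x y), IsIsometric p → CoveredByRooted G r k p},
    (k : ℕ∞)

/-- The distance in `G` between two sets of vertices. -/
noncomputable def setDist {V : Type u} (G : SimpleGraph V) (X Y : Set V) : ℕ∞ :=
  ⨅ x ∈ X, ⨅ y ∈ Y, G.edist x y

/-- A `K`-fat minor model of `H` in `G`. Connected subgraphs are nonempty. -/
structure FatMinorModel (K : ℕ) {W : Type w} (H : SimpleGraph W) {V : Type u}
    (G : SimpleGraph V) where
  branchSet : W → G.Subgraph
  branchPath : H.edgeSet → G.Subgraph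
  branchSet_connected : ∀ a, (branchSet a).Connected
  branchPath_connected : ∀ e, (branchPath e).Connected
  incident : ∀ (a : W) (e : H.edgeSet), a ∈ (e : Sym2 W) →
    ((branchSet a).verts ∩ (branchPath e).verts).Nonempty
  far_set_set : ∀ a b : W, a ≠ b →
    (K : ℕ∞) ≤ setDist G (branchSet a).verts (branchSet b).verts
  far_path_path : ∀ e f : H.edgeSet, e ≠ f →
    (K : ℕ∞) ≤ setDist G (branchPath e).verts (branchPath f).verts
  far_set_path : ∀ (a : W) (e : H.edgeSet), a ∉ (e : Sym2 W) →
    (K : ℕ∞) ≤ setDist G (branchSet a).verts (branchPath e).verts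

/-- `H` is a `K`-fat minor of `G`. -/
def IsFatMinor (K : ℕ) {W : Type w} (H : SimpleGraph W) {V : Type u} (G : SimpleGraph V) : Prop :=
  Nonempty (FatMinorModel K H G)

/-- A finite simple graph. -/
structure FiniteGraph where
  V : Type u
  finite : Finite V
  graph : SimpleGraph V

/-- The class `𝒢` contains `H` as an asymptotic minor. -/
def ContainsAsymptoticMinor (𝒢 : Set FiniteGraph.{u}) {W : Type w} (H : SimpleGraph W) : Prop :=
  ∀ K : ℕ, 1 ≤ K → ∃ G ∈ 𝒢, IsFatMinor K H G.graph

/-- The class `𝒢` is `H`-asymptotic minor-free. -/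
def AsymptoticMinorFree (𝒢 : Set FiniteGraph.{u}) {W : Type w} (H : SimpleGraph W) : Prop :=
  ¬ ContainsAsymptoticMinor 𝒢 H

/-- The graph `U_t`: a path with `t` vertices together with a universal vertex. -/
def fan (t : ℕ) : SimpleGraph (Fin t ⊕ Unit) :=
  (SimpleGraph.pathGraph t ⊕g (⊥ : SimpleGraph Unit)) ⊔ completeBipartiteGraph (Fin t) Unit

/-- The complete bipartite graph `K_{2,t}`. -/
abbrev K2 (t : ℕ) : SimpleGraph (Fin 2 ⊕ Fin t) :=
  completeBipartiteGraph (Fin 2) (Fin t)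

end CoarseGraph

namespace CoarseGraph

open SimpleGraph

/-! For the bound on the complexity, let h(s) be the distance from the s-th vertex of an isometric
path P to the root r. This function is 1-Lipschitz, and a stretch of P over which h changes by the
full length of the stretch lies on a geodesic from r. So P is cut greedily wherever the change of h
falls short of the length (`SlackGap`, `exists_slackGaps_or_cover`). If few pieces suffice, P is
covered. Otherwise the shortfalls add up and give t + 2 places on P with large shortfall between any
two.

Geodesics from these places to r, trimmed to start where they finally leave the neighbourhood of P
(`exists_geodesic_leaving`), keep their first 3K steps far from one another, since an early
encounter would contradict the shortfall. P and the union of the remaining tails, which meet in r,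
are the two large branch sets of a K-fat K_{2,t}. The initial segments supply the t small branch
sets and the connecting paths (`isFatMinor_K2_of_geodesics`).

For the fan, the model of its path becomes one large branch set and the hub the other. Each spoke
joins the two, and a middle part of it, far from both, is a small branch set
(`WalkConnected.exists_middle`). The statement on classes follows by applying this with 4K in place
of K. -/

variable {V : Type u} {G : SimpleGraph V}

/-! ### Separation of vertex sets and thickenings -/

/-- Any two vertices of `X` and `Y` are at distance at least `n` in `G`. -/
def Far (G : SimpleGraph V) (n : ℕ) (X Y : Set V) : Prop :=
  ∀ x ∈ X, ∀ y ∈ Y, (n : ℕ∞) ≤ G.edist x y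

theorem le_setDist_iff {n : ℕ} {X Y : Set V} : (n : ℕ∞) ≤ setDist G X Y ↔ Far G n X Y := by
  simp [setDist, Far, le_iInf_iff]

theorem Far.symm {n : ℕ} {X Y : Set V} (h : Far G n X Y) : Far G n Y X :=
  fun y hy x hx => by rw [edist_comm]; exact h x hx y hy

theorem Far.mono {n : ℕ} {X Y X' Y' : Set V} (h : Far G n X Y) (hX : X' ⊆ X) (hY : Y' ⊆ Y) :
    Far G n X' Y' :=
  fun x hx y hy => h x (hX hx) y (hY hy)

theorem Far.of_le {m n : ℕ} {X Y : Set V} (h : Far G n X Y) (hmn : m ≤ n) : Far G m X Y :=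
  fun x hx y hy => le_trans (by exact_mod_cast hmn) (h x hx y hy)

theorem far_of_le_dist (hG : G.Connected) {n : ℕ} {X Y : Set V}
    (h : ∀ x ∈ X, ∀ y ∈ Y, n ≤ G.dist x y) : Far G n X Y := by
  intro x hx y hy
  rw [← (hG x y).coe_dist_eq_edist]
  exact_mod_cast h x hx y hy

/-- The vertices at distance at most `d` from `X`. -/
def thicken (G : SimpleGraph V) (d : ℕ) (X : Set V) : Set V :=
  {v | ∃ x ∈ X, G.edist x v ≤ d}

theorem subset_thicken (d : ℕ) (X : Set V) : X ⊆ thicken G d X :=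
  fun x hx => ⟨x, hx, by simp⟩

theorem Far.thicken {n d e m : ℕ} {X Y : Set V} (h : Far G n X Y) (hn : m + d + e ≤ n) :
    Far G m (thicken G d X) (thicken G e Y) := by
  rintro x' ⟨x, hx, hx'⟩ y' ⟨y, hy, hy'⟩
  by_contra! hlt
  have h1 : G.edist x y ≤ d + (G.edist x' y' + e) := by
    calc G.edist x y ≤ G.edist x x' + G.edist x' y := G.edist_triangle
      _ ≤ G.edist x x' + (G.edist x' y' + G.edist y' y) := by gcongr; exact G.edist_triangle
      _ ≤ _ := by rw [G.edist_comm (u := y') (v := y)]; gcongr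
  have h2 := (h x hx y hy).trans h1
  lift G.edist x' y' to ℕ using ne_top_of_lt hlt with D
  norm_cast at h2 hlt
  omega

/-! ### Connected vertex sets -/

/-- `s` is nonempty and its vertices are joined by walks inside `s`. -/
def WalkConnected (G : SimpleGraph V) (s : Set V) : Prop :=
  s.Nonempty ∧ ∀ a ∈ s, ∀ b ∈ s, ∃ p : G.Walk a b, ∀ x ∈ p.support, x ∈ s

theorem WalkConnected.of_root {s : Set V} (a : V) (ha : a ∈ s)
    (h : ∀ b ∈ s, ∃ p : G.Walk a b, ∀ x ∈ p.support, x ∈ s) : WalkConnected G s := by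
  refine ⟨⟨a, ha⟩, fun b hb c hc => ?_⟩
  obtain ⟨p, hp⟩ := h b hb
  obtain ⟨q, hq⟩ := h c hc
  refine ⟨p.reverse.append q, fun x hx => ?_⟩
  rw [Walk.mem_support_append_iff] at hx
  rcases hx with hx | hx
  · exact hp x (by simpa using hx)
  · exact hq x hx

theorem WalkConnected.extend {s t : Set V} (ht : WalkConnected G t) (hts : t ⊆ s) {a b c : V}
    (hb : b ∈ t) (hc : c ∈ t) (h : ∃ p : G.Walk a b, ∀ x ∈ p.support, x ∈ s) :
    ∃ p : G.Walk a c, ∀ x ∈ p.support, x ∈ s := by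
  obtain ⟨p, hp⟩ := h
  obtain ⟨q, hq⟩ := ht.2 b hb c hc
  refine ⟨p.append q, fun x hx => ?_⟩
  rw [Walk.mem_support_append_iff] at hx
  exact hx.elim (hp x) (fun hx => hts (hq x hx))

theorem WalkConnected.iUnion {ι : Type*} [Nonempty ι] {s : ι → Set V} (a : V)
    (ha : ∀ i, a ∈ s i) (h : ∀ i, WalkConnected G (s i)) : WalkConnected G (⋃ i, s i) := by
  refine .of_root a (Set.mem_iUnion.2 ⟨Classical.arbitrary ι, ha _⟩) fun b hb => ?_
  obtain ⟨i, hi⟩ := Set.mem_iUnion.1 hb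
  obtain ⟨p, hp⟩ := (h i).2 a (ha i) b hi
  exact ⟨p, fun x hx => Set.mem_iUnion.2 ⟨i, hp x hx⟩⟩

theorem WalkConnected.union {s t : Set V} (hs : WalkConnected G s) (ht : WalkConnected G t)
    (a : V) (has : a ∈ s) (hat : a ∈ t) : WalkConnected G (s ∪ t) := by
  rw [Set.union_eq_iUnion]
  exact .iUnion a (by simp [has, hat]) (by simp [hs, ht])

theorem walkConnected_support {a b : V} (p : G.Walk a b) : WalkConnected G {v | v ∈ p.support} := by
  classical
  exact .of_root a p.start_mem_support fun c hc =>
    ⟨p.takeUntil c hc, fun x hx => p.support_takeUntil_subset_support hc hx⟩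

theorem _root_.SimpleGraph.Subgraph.Connected.walkConnected {H : G.Subgraph} (h : H.Connected) :
    WalkConnected G H.verts := by
  obtain ⟨hne, hw⟩ := H.connected_iff_forall_exists_walk_subgraph.1 h
  refine ⟨hne, fun a ha b hb => ?_⟩
  obtain ⟨p, hp⟩ := hw ha hb
  exact ⟨p, fun x hx => hp.1 (by simpa using hx)⟩

theorem WalkConnected.connected_induce {s : Set V} (h : WalkConnected G s) :
    ((⊤ : G.Subgraph).induce s).Connected := by
  rw [← connected_induce_iff]
  obtain ⟨⟨a, ha⟩, hw⟩ := h
  refine G.induce_connected_of_patches a ha fun {b} hb => ?_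
  obtain ⟨p, hp⟩ := hw a ha b hb
  exact ⟨{v | v ∈ p.support}, hp, p.start_mem_support, p.end_mem_support,
    p.connected_induce_support _ _⟩

/-! ### Fat K_{2,t} models from vertex sets -/

/-- The sets that make up a fat `K_{2,t}` minor model. -/
theorem isFatMinor_K2_of_sets {K t : ℕ} (B : Fin 2 → Set V) (C : Fin t → Set V)
    (P : Fin 2 → Fin t → Set V)
    (hB : ∀ a, WalkConnected G (B a)) (hC : ∀ i, WalkConnected G (C i))
    (hP : ∀ a i, WalkConnected G (P a i))
    (hBP : ∀ a i, (B a ∩ P a i).Nonempty) (hCP : ∀ a i, (C i ∩ P a i).Nonempty)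
    (hBB : Far G K (B 0) (B 1)) (hBC : ∀ a i, Far G K (B a) (C i))
    (hCC : ∀ i j, i ≠ j → Far G K (C i) (C j))
    (hP01 : ∀ i, Far G K (P 0 i) (P 1 i))
    (hPP : ∀ a b i j, i ≠ j → Far G K (P a i) (P b j))
    (hB0 : ∀ i, Far G K (B 0) (P 1 i)) (hB1 : ∀ i, Far G K (B 1) (P 0 i))
    (hCP' : ∀ i a j, i ≠ j → Far G K (C i) (P a j)) : IsFatMinor K (K2 t) G := by
  have hedge : ∀ e : (K2 t).edgeSet, ∃ ai : Fin 2 × Fin t,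
      (e : Sym2 (Fin 2 ⊕ Fin t)) = s(Sum.inl ai.1, Sum.inr ai.2) := by
    rintro ⟨e, he⟩
    induction e using Sym2.ind with
    | _ x y =>
      rcases x with a | i <;> rcases y with b | j <;> simp at he
      · exact ⟨(a, j), rfl⟩
      · exact ⟨(b, i), Sym2.eq_swap⟩
  choose φ hφ using hedge
  have hinj : ∀ e f, e ≠ f → φ e ≠ φ f := fun e f hne h =>
    hne (Subtype.ext (by rw [hφ e, hφ f, h]))
  refine ⟨⟨fun v => (⊤ : G.Subgraph).induce (Sum.elim B C v),
    fun e => (⊤ : G.Subgraph).induce (P (φ e).1 (φ e).2), ?_, ?_, ?_, ?_, ?_, ?_⟩⟩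
  · rintro (a | i)
    · exact (hB a).connected_induce
    · exact (hC i).connected_induce
  · exact fun e => (hP _ _).connected_induce
  · intro v e hv
    rw [hφ e] at hv
    rcases Sym2.mem_iff.1 hv with rfl | rfl
    · exact hBP _ _
    · exact hCP _ _
  · rintro (a | i) (b | j) hne <;> rw [le_setDist_iff]
    · have hab : a ≠ b := fun h => hne (by rw [h])
      fin_cases a <;> fin_cases b <;> first | exact absurd rfl hab | exact hBB | exact hBB.symm
    · exact hBC a j
    · exact (hBC b i).symm
    · exact hCC i j fun h => hne (by rw [h])
  · intro e f hne
    rw [le_setDist_iff]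
    have h := hinj e f hne
    generalize φ e = x at h ⊢
    generalize φ f = y at h ⊢
    obtain ⟨a, i⟩ := x
    obtain ⟨b, j⟩ := y
    by_cases hij : i = j
    · subst hij
      have hab : a ≠ b := fun h' => h (by rw [h'])
      fin_cases a <;> fin_cases b <;>
        first | exact absurd rfl hab | exact hP01 i | exact (hP01 i).symm
    · exact hPP a b i j hij
  · intro v e hv
    rw [le_setDist_iff]
    rw [hφ e] at hv
    generalize φ e = x at hv ⊢
    obtain ⟨b, j⟩ := x
    rcases v with a | i
    · have hab : a ≠ b := fun h' => hv (by simp [h'])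
      fin_cases a <;> fin_cases b <;>
        first | exact absurd rfl hab | exact hB0 j | exact hB1 j
    · exact hCP' i b j fun h' => hv (by simp [h'])

/-! ### The middle of a connected set joining two distant sets -/

/-- A walk inside `Z` of minimal length from a vertex in `S` to a vertex in `T`
meets `S` and `T` only in its end-vertices. -/
theorem WalkConnected.exists_walk_between {Z S T : Set V} (hZ : WalkConnected G Z)
    (hS : (S ∩ Z).Nonempty) (hT : (T ∩ Z).Nonempty) :
    ∃ (a b : V) (p : G.Walk a b), a ∈ S ∧ b ∈ T ∧ (∀ x ∈ p.support, x ∈ Z) ∧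
      (∀ x ∈ p.support, x ∈ S → x = a) ∧ ∀ x ∈ p.support, x ∈ T → x = b := by
  classical
  have hex : ∃ n : ℕ, ∃ (a b : V) (p : G.Walk a b), a ∈ S ∧ b ∈ T ∧
      (∀ x ∈ p.support, x ∈ Z) ∧ p.length = n := by
    obtain ⟨a, ha, haZ⟩ := hS
    obtain ⟨b, hb, hbZ⟩ := hT
    obtain ⟨p, hp⟩ := hZ.2 a haZ b hbZ
    exact ⟨_, a, b, p, ha, hb, hp, rfl⟩
  obtain ⟨a, b, p, ha, hb, hp, hlen⟩ := Nat.find_spec hex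
  have hmin : ∀ (c d : V) (q : G.Walk c d), c ∈ S → d ∈ T → (∀ x ∈ q.support, x ∈ Z) →
      p.length ≤ q.length := fun c d q hc hd hq =>
    hlen ▸ Nat.find_min' hex ⟨c, d, q, hc, hd, hq, rfl⟩
  refine ⟨a, b, p, ha, hb, hp, fun x hx hxS => ?_, fun x hx hxT => ?_⟩
  · have h1 := hmin x b (p.dropUntil x hx) hxS hb
      fun y hy => hp y (p.support_dropUntil_subset_support hx hy)
    have h2 : (p.takeUntil x hx).length + (p.dropUntil x hx).length = p.length := by
      rw [← Walk.length_append, Walk.take_spec]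
    exact (Walk.eq_of_length_eq_zero (p := p.takeUntil x hx) (by omega)).symm
  · have h1 := hmin a x (p.takeUntil x hx) ha hxT
      fun y hy => hp y (p.support_takeUntil_subset_support hx hy)
    have h2 : (p.takeUntil x hx).length + (p.dropUntil x hx).length = p.length := by
      rw [← Walk.length_append, Walk.take_spec]
    exact Walk.eq_of_length_eq_zero (p := p.dropUntil x hx) (by omega)

theorem mem_thicken_of_adj {d : ℕ} {X : Set V} {x a b : V} (hx : x ∈ X) (hab : G.Adj a b)
    (h : G.edist x a < d) : b ∈ thicken G d X := by
  refine ⟨x, hx, (G.edist_triangle (v := a)).trans ?_⟩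
  rw [edist_eq_one_iff_adj.2 hab]
  exact Order.add_one_le_of_lt h

/-- A vertex of the walk closer than `d` to `X` can only be `a`. The vertex after `a` would then
still lie in the thickening, against uniqueness of `a`. -/
theorem far_support_of_mem_thicken_imp_eq {d K : ℕ} {X Y : Set V} (hXY : Far G K X Y)
    (hd : 3 * d ≤ K) {a b : V} (p : G.Walk a b) (hb : b ∈ thicken G d Y)
    (h : ∀ x ∈ p.support, x ∈ thicken G d X → x = a) : Far G d X {v | v ∈ p.support} := by
  intro x hx v hv
  by_contra! hlt
  obtain rfl := h v hv ⟨x, hx, hlt.le⟩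
  cases p with
  | nil =>
    -- A trivial walk puts `a` in both thickenings, which are at distance at least `d`; this leaves
    -- only `d = 0`.
    have := hXY.thicken (m := d) (d := d) (e := d) (by omega) _ ⟨x, hx, hlt.le⟩ _ hb
    have h0 : d = 0 := by simpa using this
    simp [h0] at hlt
  | cons hadj q =>
    refine hadj.ne' (h _ ?_ (mem_thicken_of_adj hx hadj hlt))
    simp

/-- The vertices of a short walk from `X` to a vertex of `thicken G d X`. -/
theorem exists_link {d : ℕ} {X : Set V} {a : V} (ha : a ∈ thicken G d X) :
    ∃ P : Set V, WalkConnected G P ∧ (X ∩ P).Nonempty ∧ a ∈ P ∧ P ⊆ thicken G d X ∧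
      P ⊆ thicken G d {a} := by
  classical
  obtain ⟨x, hx, hxa⟩ := ha
  have hne : G.edist x a ≠ ⊤ := ne_top_of_le_ne_top (ENat.natCast_ne_top d) hxa
  obtain ⟨p, hp⟩ := exists_walk_of_edist_ne_top hne
  rw [← hp] at hxa
  have hxa' : p.length ≤ d := by exact_mod_cast hxa
  refine ⟨{v | v ∈ p.support}, walkConnected_support p, ⟨x, hx, p.start_mem_support⟩,
    p.end_mem_support, fun v hv => ⟨x, hx, ?_⟩, fun v hv => ⟨a, rfl, ?_⟩⟩
  · refine (edist_le (p.takeUntil v hv)).trans ?_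
    exact_mod_cast (p.length_takeUntil_le_length hv).trans hxa'
  · rw [edist_comm]
    refine (edist_le (p.dropUntil v hv)).trans ?_
    exact_mod_cast (p.length_dropUntil_le_length hv).trans hxa'

/-- A connected set joining two distant sets contains a part far from both,
with short links to them. -/
theorem WalkConnected.exists_middle {d K : ℕ} {X Y Z : Set V} (hZ : WalkConnected G Z)
    (hXY : Far G K X Y) (hd : 3 * d ≤ K) (hX : (X ∩ Z).Nonempty) (hY : (Y ∩ Z).Nonempty) :
    ∃ (C P Q : Set V), WalkConnected G C ∧ WalkConnected G P ∧ WalkConnected G Q ∧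
      (X ∩ P).Nonempty ∧ (C ∩ P).Nonempty ∧ (Y ∩ Q).Nonempty ∧ (C ∩ Q).Nonempty ∧
      C ⊆ Z ∧ P ⊆ thicken G d X ∧ P ⊆ thicken G d Z ∧ Q ⊆ thicken G d Y ∧ Q ⊆ thicken G d Z ∧
      Far G d X C ∧ Far G d Y C := by
  obtain ⟨a, b, p, ha, hb, hp, hpa, hpb⟩ := hZ.exists_walk_between
    (hX.mono (Set.inter_subset_inter_left _ (subset_thicken d X)))
    (hY.mono (Set.inter_subset_inter_left _ (subset_thicken d Y)))
  obtain ⟨P, hP, hXP, haP, hPX, hPa⟩ := exists_link ha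
  obtain ⟨Q, hQ, hYQ, hbQ, hQY, hQb⟩ := exists_link hb
  have hsub : ∀ c ∈ p.support, thicken G d {c} ⊆ thicken G d Z := by
    rintro c hc v ⟨x, hx, hxv⟩
    obtain rfl : x = c := hx
    exact ⟨x, hp x hc, hxv⟩
  refine ⟨{v | v ∈ p.support}, P, Q, walkConnected_support p, hP, hQ, hXP,
    ⟨a, p.start_mem_support, haP⟩, hYQ, ⟨b, p.end_mem_support, hbQ⟩, hp, hPX,
    hPa.trans (hsub a p.start_mem_support), hQY, hQb.trans (hsub b p.end_mem_support),
    far_support_of_mem_thicken_imp_eq hXY hd p hb hpa, ?_⟩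
  have := far_support_of_mem_thicken_imp_eq hXY.symm hd p.reverse ha
    (fun x hx => hpb x (by simpa using hx))
  simpa using this

/-! ### From the fan to K_{2,t} -/

/-- A fat fan minor yields a fat `K_{2,t}` minor. -/
theorem isFatMinor_K2_of_fan {K t : ℕ} (ht : 1 ≤ t) (h : IsFatMinor K (fan t) G) :
    IsFatMinor (K / 4) (K2 t) G := by
  obtain ⟨M⟩ := h
  -- Only `3 * d ≤ K` is used below.
  set d := K / 4 with hd
  have hspoke : ∀ i : Fin t, s(Sum.inl i, Sum.inr ()) ∈ (fan t).edgeSet := fun i => by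
    simp [fan]
  let F : Fin t → (fan t).edgeSet := fun i => ⟨_, hspoke i⟩
  let B : Fin t ⊕ Unit → Set V := fun a => (M.branchSet a).verts
  let P : (fan t).edgeSet → Set V := fun e => (M.branchPath e).verts
  let U := B (Sum.inr ())
  have hB : ∀ a, WalkConnected G (B a) := fun a => (M.branchSet_connected a).walkConnected
  have hP : ∀ e, WalkConnected G (P e) := fun e => (M.branchPath_connected e).walkConnected
  have hBB : ∀ a b, a ≠ b → Far G K (B a) (B b) := fun a b hab =>
    le_setDist_iff.1 (M.far_set_set a b hab)
  have hPP : ∀ e f, e ≠ f → Far G K (P e) (P f) := fun e f hef =>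
    le_setDist_iff.1 (M.far_path_path e f hef)
  have hBP : ∀ a (e : (fan t).edgeSet), a ∉ (e : Sym2 _) → Far G K (B a) (P e) := fun a e hae =>
    le_setDist_iff.1 (M.far_set_path a e hae)
  have hinc : ∀ a (e : (fan t).edgeSet), a ∈ (e : Sym2 _) → (B a ∩ P e).Nonempty :=
    fun a e hae => M.incident a e hae
  -- The whole model of the path, that is, everything not involving the hub.
  let R : Set V := (⋃ i : Fin t, B (Sum.inl i)) ∪
    ⋃ e : {e : (fan t).edgeSet // Sum.inr () ∉ (e : Sym2 (Fin t ⊕ Unit))}, P e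
  have hBR : ∀ i, B (Sum.inl i) ⊆ R := fun i =>
    (Set.subset_iUnion (fun i : Fin t => B (Sum.inl i)) i).trans Set.subset_union_left
  have hPR : ∀ e : (fan t).edgeSet, Sum.inr () ∉ (e : Sym2 (Fin t ⊕ Unit)) → P e ⊆ R :=
    fun e he => (Set.subset_iUnion (fun e : {e : (fan t).edgeSet //
      Sum.inr () ∉ (e : Sym2 (Fin t ⊕ Unit))} => P e) ⟨e, he⟩).trans Set.subset_union_right
  have hR_of : ∀ n (Y : Set V), (∀ i, Far G n (B (Sum.inl i)) Y) →
      (∀ e : (fan t).edgeSet, Sum.inr () ∉ (e : Sym2 (Fin t ⊕ Unit)) → Far G n (P e) Y) →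
      Far G n R Y := by
    rintro n Y h1 h2 x (hx | hx)
    · obtain ⟨i, hi⟩ := Set.mem_iUnion.1 hx
      exact h1 i x hi
    · obtain ⟨e, he⟩ := Set.mem_iUnion.1 hx
      exact h2 e e.2 x he
  have hR : WalkConnected G R := by
    obtain ⟨r, hr⟩ := (hB (Sum.inl ⟨0, ht⟩)).1
    have hpath : ∀ (n : ℕ) (hn : n < t), ∀ v ∈ B (Sum.inl ⟨n, hn⟩),
        ∃ p : G.Walk r v, ∀ x ∈ p.support, x ∈ R := by
      intro n
      induction n with
      | zero =>
        intro hn v hv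
        exact (hB _).extend (hBR _) hr hv ⟨Walk.nil, by simpa using hBR _ hr⟩
      | succ n ih =>
        intro hn v hv
        have he : s(Sum.inl ⟨n, by omega⟩, Sum.inl ⟨n + 1, hn⟩) ∈ (fan t).edgeSet := by
          simp [fan, pathGraph_adj]
        obtain ⟨x, hx1, hx2⟩ := hinc (Sum.inl ⟨n, by omega⟩) ⟨_, he⟩ (by simp)
        obtain ⟨y, hy1, hy2⟩ := hinc (Sum.inl ⟨n + 1, hn⟩) ⟨_, he⟩ (by simp)
        exact (hB _).extend (hBR _) hy1 hv
          ((hP ⟨_, he⟩).extend (hPR _ (by simp)) hx2 hy2 (ih (by omega) x hx1))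
    refine .of_root r (hBR _ hr) ?_
    rintro v (hv | hv)
    · obtain ⟨i, hi⟩ := Set.mem_iUnion.1 hv
      exact hpath i i.2 v hi
    · obtain ⟨⟨e, he⟩, hve⟩ := Set.mem_iUnion.1 hv
      obtain ⟨i, hi⟩ : ∃ i : Fin t, Sum.inl i ∈ (e : Sym2 (Fin t ⊕ Unit)) := by
        obtain ⟨e, he'⟩ := e
        induction e using Sym2.ind with
        | _ x y =>
          rcases x with i | ⟨⟩
          · exact ⟨i, by simp⟩
          · simp at he
      obtain ⟨x, hx1, hx2⟩ := hinc _ e hi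
      exact (hP e).extend (hPR e he) hx2 hve (hpath i i.2 x hx1)
  have hmid := fun i => (hP (F i)).exists_middle (hBB (Sum.inl i) (Sum.inr ()) (by simp))
    (d := d) (by omega) (hinc _ (F i) (by simp [F])) (hinc _ (F i) (by simp [F]))
  choose C Q₀ Q₁ hC hQ₀ hQ₁ hBQ₀ hCQ₀ hUQ₁ hCQ₁ hCF hQ₀B hQ₀F hQ₁U hQ₁F hBC hUC using hmid
  have hFF : ∀ i j, i ≠ j → Far G K (P (F i)) (P (F j)) := fun i j hij =>
    hPP _ _ fun h => hij (by simpa [F] using h)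
  have hQF : ∀ (a : Fin 2) i, (![Q₀, Q₁] a) i ⊆ thicken G d (P (F i)) := by
    intro a i
    fin_cases a
    · exact hQ₀F i
    · exact hQ₁F i
  have hself : ∀ X : Set V, X ⊆ thicken G 0 X := subset_thicken 0
  have hRU : Far G K R U := hR_of _ _ (fun i => hBB _ _ (by simp)) fun e he => (hBP _ e he).symm
  have hBF : ∀ i j, i ≠ j → Far G K (B (Sum.inl i)) (P (F j)) := fun i j hij =>
    hBP _ _ (by simpa [F] using hij)
  have hPF : ∀ e : (fan t).edgeSet, Sum.inr () ∉ (e : Sym2 (Fin t ⊕ Unit)) → ∀ j,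
      Far G K (P e) (P (F j)) := fun e he j =>
    hPP _ _ fun h => he (by simp [h, F])
  refine isFatMinor_K2_of_sets ![R, U] C ![Q₀, Q₁] ?_ hC ?_ ?_ ?_ ?_ ?_ ?_ ?_ ?_ ?_ ?_ ?_
  · simp [Fin.forall_fin_two, hR, hB, U]
  · simp [Fin.forall_fin_two, hQ₀, hQ₁]
  · rw [Fin.forall_fin_two]
    exact ⟨fun i => (hBQ₀ i).mono (Set.inter_subset_inter_left _ (hBR i)), hUQ₁⟩
  · rw [Fin.forall_fin_two]
    exact ⟨hCQ₀, hCQ₁⟩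
  · exact hRU.of_le (by omega)
  · rw [Fin.forall_fin_two]
    refine ⟨fun i => hR_of _ _ (fun j => ?_) fun e he => ?_, hUC⟩
    · by_cases hij : j = i
      · exact hij ▸ hBC j
      · exact ((hBF j i hij).mono subset_rfl (hCF i)).of_le (by omega)
    · exact ((hPF e he i).mono subset_rfl (hCF i)).of_le (by omega)
  · exact fun i j hij => ((hFF i j hij).mono (hCF i) (hCF j)).of_le (by omega)
  -- Each link stays within `d` of the branch set it touches and of its spoke. So a distance `K`
  -- drops by at most `2 * d`, and at least `d` remains.
  · exact fun i => ((hBB _ _ (by simp)).thicken (by omega)).mono (hQ₀B i) (hQ₁U i)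
  · exact fun a b i j hij => ((hFF i j hij).thicken (by omega)).mono (hQF a i) (hQF b j)
  · exact fun i => (hRU.thicken (by omega)).mono (hself R) (hQ₁U i)
  · exact fun i => ((hRU.symm.mono subset_rfl (hBR i)).thicken (by omega)).mono (hself U) (hQ₀B i)
  · exact fun i a j hij =>
      ((hFF i j hij).thicken (by omega)).mono ((hCF i).trans (hself _)) (hQF a j)

theorem asymptoticMinorFree_fan {t : ℕ} (ht : 1 ≤ t) {𝒢 : Set FiniteGraph.{u}}
    (h : AsymptoticMinorFree 𝒢 (K2 t)) : AsymptoticMinorFree 𝒢 (fan t) := by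
  refine fun hfan => h fun K hK => ?_
  obtain ⟨G, hG, hGf⟩ := hfan (4 * K) (by omega)
  have := isFatMinor_K2_of_fan ht hGf
  rw [Nat.mul_div_cancel_left K (by norm_num)] at this
  exact ⟨G, hG, this⟩

/-! ### Distances along walks and isometric paths -/

theorem dist_getVert_getVert_le (hG : G.Connected) {a b : V} (p : G.Walk a b) {k l : ℕ}
    (hkl : k ≤ l) : G.dist (p.getVert k) (p.getVert l) ≤ l - k := by
  induction l, hkl using Nat.le_induction with
  | base => simp
  | succ l hkl ih =>
    have h1 := hG.dist_triangle (u := p.getVert k) (v := p.getVert l) (w := p.getVert (l + 1))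
    have h2 : G.dist (p.getVert l) (p.getVert (l + 1)) ≤ 1 := by
      by_cases hl : l < p.length
      · exact (dist_eq_one_iff_adj.2 (p.adj_getVert_succ hl)).le
      · rw [p.getVert_of_length_le (by omega), p.getVert_of_length_le (by omega)]
        simp
    omega

/-- The upper bounds on the three stretches cut off by `k` and `l` add up to the distance of the
ends, so each of them is tight. -/
theorem IsIsometric.dist_getVert_getVert (hG : G.Connected) {a b : V} {p : G.Walk a b}
    (hp : IsIsometric p) {k l : ℕ} (hkl : k ≤ l) (hl : l ≤ p.length) :
    G.dist (p.getVert k) (p.getVert l) = l - k := by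
  have h0 := dist_getVert_getVert_le hG p (Nat.zero_le k)
  have h1 := dist_getVert_getVert_le hG p hkl
  have h2 := dist_getVert_getVert_le hG p hl
  rw [Walk.getVert_zero] at h0
  rw [Walk.getVert_length] at h2
  have h3 := hG.dist_triangle (u := a) (v := p.getVert k) (w := b)
  have h4 := hG.dist_triangle (u := p.getVert k) (v := p.getVert l) (w := b)
  have h5 : p.length = G.dist a b := hp
  omega

/-- A contiguous set of vertices of a walk is connected. -/
theorem walkConnected_segment {a b : V} (p : G.Walk a b) {k l : ℕ} (hkl : k ≤ l) :
    WalkConnected G {v | ∃ s, k ≤ s ∧ s ≤ l ∧ v = p.getVert s} := by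
  refine .of_root (p.getVert k) ⟨k, le_rfl, hkl, rfl⟩ ?_
  rintro _ ⟨s, hks, hsl, rfl⟩
  induction s, hks using Nat.le_induction with
  | base => exact ⟨Walk.nil, by simpa using ⟨k, le_rfl, hkl, rfl⟩⟩
  | succ s hks ih =>
    obtain ⟨q, hq⟩ := ih (by omega)
    by_cases hs : s < p.length
    · refine ⟨q.concat (p.adj_getVert_succ hs), fun x hx => ?_⟩
      rw [Walk.support_concat, List.mem_append, List.mem_singleton] at hx
      rcases hx with hx | rfl
      · exact hq x hx
      · exact ⟨s + 1, by omega, hsl, rfl⟩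
    · have h : p.getVert s = p.getVert (s + 1) := by
        rw [p.getVert_of_length_le (by omega), p.getVert_of_length_le (by omega)]
      exact h ▸ ⟨q, hq⟩

/-! ### A fat K_{2,t} from geodesics to a root -/

/-- Geodesics to a common vertex `r` that start near an isometric path, leave its neighbourhood,
and whose initial vertices are far from being on a common geodesic to `r`
give a fat `K_{2,t}` minor. -/
theorem isFatMinor_K2_of_geodesics (hG : G.Connected) {K t : ℕ} (hK : 1 ≤ K) {r x y : V}
    (P : G.Walk x y) (p q : Fin (t + 2) → V) (hp : ∀ i, p i ∈ P.support)
    (hpq : ∀ i, G.dist (p i) (q i) ≤ K) (Q : ∀ i, G.Walk (q i) r) (hQ : ∀ i, IsIsometric (Q i))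
    (hfar : ∀ i s, 1 ≤ s → s ≤ (Q i).length → ∀ v ∈ P.support, K ≤ G.dist v ((Q i).getVert s))
    (hslack : ∀ i j, i ≠ j → G.dist (q i) r + 8 * K ≤ G.dist (q j) r + G.dist (q i) (q j)) :
    IsFatMinor K (K2 t) G := by
  classical
  have hlen : ∀ i, (Q i).length = G.dist (q i) r := hQ
  have hqs : ∀ i s, s ≤ (Q i).length → G.dist (q i) ((Q i).getVert s) = s := fun i s hs => by
    simpa using (hQ i).dist_getVert_getVert hG (Nat.zero_le s) hs
  have hsr : ∀ i s, s ≤ (Q i).length → G.dist ((Q i).getVert s) r = (Q i).length - s :=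
    fun i s hs => by simpa using (hQ i).dist_getVert_getVert hG hs le_rfl
  have hss : ∀ i s s', s ≤ s' → s' ≤ (Q i).length →
      G.dist ((Q i).getVert s) ((Q i).getVert s') = s' - s :=
    fun i s s' h h' => (hQ i).dist_getVert_getVert hG h h'
  -- Let D be the distance between the two vertices. Going from `q i` to `q j` through them costs at
  -- most s + D + s', and their distances to `r` differ by at most D. With `hslack` for (j, i) this
  -- gives 8K ≤ 2s + 2D.
  have hcross : ∀ i j, i ≠ j → ∀ s s', s ≤ (Q i).length → s' ≤ (Q j).length →
      4 * K ≤ s + G.dist ((Q i).getVert s) ((Q j).getVert s') := by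
    intro i j hij s s' hs hs'
    have h1 := hslack j i hij.symm
    rw [G.dist_comm (u := q j) (v := q i)] at h1
    have h2 := hG.dist_triangle (u := q i) (v := (Q i).getVert s) (w := q j)
    have h3 := hG.dist_triangle (u := (Q i).getVert s) (v := (Q j).getVert s') (w := q j)
    have h4 := hG.dist_triangle (u := (Q i).getVert s) (v := (Q j).getVert s') (w := r)
    have h4' := hG.dist_triangle (u := (Q j).getVert s') (v := (Q i).getVert s) (w := r)
    have h5 := hqs i s hs
    have h6 := hqs j s' hs'
    rw [dist_comm] at h6
    have h7 := hsr i s hs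
    have h8 := hsr j s' hs'
    have h9 := hlen i
    have h10 := hlen j
    have h11 := G.dist_comm (u := (Q j).getVert s') (v := (Q i).getVert s)
    omega
  -- Both geodesics end in `r`, so D = 0 there. A second index is needed, which `t + 2` provides
  -- even for `t = 0`.
  have hlong : ∀ i, 4 * K ≤ (Q i).length := by
    intro i
    obtain ⟨j, hj⟩ := exists_ne i
    have := hcross i j hj.symm _ _ le_rfl le_rfl
    simpa using this
  choose ℓ hℓ using fun i => hG.exists_walk_length_eq_dist (p i) (q i)
  have hlink : ∀ i, ∀ v ∈ (ℓ i).support, G.dist v (q i) ≤ K := fun i v hv => by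
    have h1 := dist_le ((ℓ i).dropUntil v hv)
    have h2 := (ℓ i).length_dropUntil_le_length hv
    have h3 := hpq i
    have h4 := hℓ i
    omega
  -- Each geodesic is cut at K, 2K and 3K. `A i` connects `P` to the small branch set on [K, 2K],
  -- the part on [2K, 3K] leads on to `D`, and `D` collects the tails, all of which contain `r`.
  let S : Fin (t + 2) → ℕ → ℕ → Set V := fun i k l =>
    {v | ∃ s, k ≤ s ∧ s ≤ l ∧ v = (Q i).getVert s}
  let A : Fin (t + 2) → Set V := fun i => {v | v ∈ (ℓ i).support} ∪ S i 0 K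
  let D : Set V := ⋃ i, S i (3 * K) (Q i).length
  let ι : Fin t → Fin (t + 2) := Fin.castAdd 2
  have hι : ∀ i j, i ≠ j → ι i ≠ ι j := fun i j hij h => hij (Fin.castAdd_injective t 2 h)
  have hPS : ∀ i k l, 1 ≤ k → l ≤ (Q i).length → Far G K {v | v ∈ P.support} (S i k l) := by
    intro i k l hk hl
    refine far_of_le_dist hG ?_
    rintro v hv _ ⟨s, hks, hsl, rfl⟩
    exact hfar i s (by omega) (by omega) v hv
  have hSS : ∀ i k l k' l', l + K ≤ k' → l' ≤ (Q i).length →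
      Far G K (S i k l) (S i k' l') := by
    intro i k l k' l' h h'
    refine far_of_le_dist hG ?_
    rintro _ ⟨s, hks, hsl, rfl⟩ _ ⟨s', hks', hsl', rfl⟩
    rw [hss i s s' (by omega) (by omega)]
    omega
  have hSS' : ∀ i j, i ≠ j → ∀ k l k' l', l ≤ 3 * K → l' ≤ (Q j).length →
      Far G K (S i k l) (S j k' l') := by
    intro i j hij k l k' l' h h'
    refine far_of_le_dist hG ?_
    rintro _ ⟨s, hks, hsl, rfl⟩ _ ⟨s', hks', hsl', rfl⟩
    have := hlong i
    have := hcross i j hij s s' (by omega) (by omega)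
    omega
  have hAS : ∀ i k l, 2 * K ≤ k → l ≤ (Q i).length → Far G K (A i) (S i k l) := by
    rintro i k l hk hl v (hv | hv)
    · revert v
      refine far_of_le_dist hG ?_
      rintro v hv _ ⟨s, hks, hsl, rfl⟩
      have h1 := hlink i v hv
      have h2 := hqs i s (by omega)
      have h3 := hG.dist_triangle (u := q i) (v := v) (w := (Q i).getVert s)
      rw [G.dist_comm (u := q i) (v := v)] at h3
      omega
    · exact hSS i _ _ _ _ (by omega) hl v hv
  have hAS' : ∀ i j, i ≠ j → ∀ k l, l ≤ (Q j).length → Far G K (A i) (S j k l) := by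
    rintro i j hij k l hl v (hv | hv)
    · revert v
      refine far_of_le_dist hG ?_
      rintro v hv _ ⟨s, hks, hsl, rfl⟩
      have h1 := hlink i v hv
      have h2 := hcross i j hij 0 s (by omega) (by omega)
      have h3 := hG.dist_triangle (u := q i) (v := v) (w := (Q j).getVert s)
      rw [G.dist_comm (u := q i) (v := v)] at h3
      rw [Walk.getVert_zero] at h2
      omega
    · exact hSS' i j hij _ _ _ _ (by omega) hl v hv
  have hAA : ∀ i j, i ≠ j → Far G K (A i) (A j) := by
    rintro i j hij v hv w (hw | hw)
    · rcases hv with hv | hv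
      · revert v w
        suffices Far G K {v | v ∈ (ℓ i).support} {v | v ∈ (ℓ j).support} from
          fun v w hw hv => this v hv w hw
        refine far_of_le_dist hG ?_
        intro v hv w hw
        have h1 := hlink i v hv
        have h1' := hlink j w hw
        have h2 := hcross i j hij 0 0 (by omega) (by omega)
        have h3 := hG.dist_triangle (u := q i) (v := v) (w := q j)
        have h4 := hG.dist_triangle (u := v) (v := w) (w := q j)
        rw [G.dist_comm (u := q i) (v := v)] at h3
        rw [Walk.getVert_zero, Walk.getVert_zero] at h2
        omega
      · have := hlong i
        exact (hAS' j i hij.symm _ _ (by omega)).symm v hv w (Or.inl hw)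
    · have := hlong j
      exact hAS' i j hij _ _ (by omega) v hv w hw
  have hD : ∀ Y : Set V, (∀ j, Far G K Y (S j (3 * K) (Q j).length)) → Far G K Y D := by
    intro Y h v hv w hw
    obtain ⟨j, hj⟩ := Set.mem_iUnion.1 hw
    exact h j v hv w hj
  have hmem : ∀ i k l s, k ≤ s → s ≤ l → (Q i).getVert s ∈ S i k l :=
    fun i k l s h h' => ⟨s, h, h', rfl⟩
  have hA : ∀ i, WalkConnected G (A i) := fun i =>
    (walkConnected_support (ℓ i)).union (walkConnected_segment (Q i) (Nat.zero_le K)) (q i)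
      (ℓ i).end_mem_support ⟨0, le_rfl, by omega, by simp⟩
  have h3K : ∀ i, 3 * K ≤ (Q i).length := fun i => by have := hlong i; omega
  have h2K : ∀ i, 2 * K ≤ (Q i).length := fun i => by have := hlong i; omega
  have hfin : ∀ i j : Fin t, i ≠ j → ∀ a b : Fin 2,
      Far G K ((![fun i => A (ι i), fun i => S (ι i) (2 * K) (3 * K)] a) i)
        ((![fun i => A (ι i), fun i => S (ι i) (2 * K) (3 * K)] b) j) := by
    intro i j hij a b
    fin_cases a <;> fin_cases b
    · exact hAA _ _ (hι i j hij)
    · exact hAS' _ _ (hι i j hij) _ _ (h3K _)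
    · exact (hAS' _ _ (hι i j hij).symm _ _ (h3K _)).symm
    · exact hSS' _ _ (hι i j hij) _ _ _ _ le_rfl (h3K _)
  refine isFatMinor_K2_of_sets ![{v | v ∈ P.support}, D] (fun i => S (ι i) K (2 * K))
    ![fun i => A (ι i), fun i => S (ι i) (2 * K) (3 * K)] ?_ ?_ ?_ ?_ ?_ ?_ ?_ ?_ ?_
    (fun a b i j hij => hfin i j hij a b) ?_ ?_ ?_
  · rw [Fin.forall_fin_two]
    refine ⟨walkConnected_support P, .iUnion r (fun i => ?_) fun i =>
      walkConnected_segment (Q i) (h3K i)⟩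
    exact ⟨_, h3K i, le_rfl, by simp⟩
  · exact fun i => walkConnected_segment _ (by omega)
  · rw [Fin.forall_fin_two]
    exact ⟨fun i => hA _, fun i => walkConnected_segment _ (by omega)⟩
  · rw [Fin.forall_fin_two]
    refine ⟨fun i => ⟨p (ι i), hp _, Or.inl (ℓ (ι i)).start_mem_support⟩, fun i => ?_⟩
    exact ⟨_, Set.mem_iUnion.2 ⟨ι i, hmem _ _ _ (3 * K) le_rfl (h3K _)⟩,
      hmem _ _ _ (3 * K) (by omega) le_rfl⟩
  · rw [Fin.forall_fin_two]
    exact ⟨fun i => ⟨_, hmem _ _ _ K le_rfl (by omega), Or.inr (hmem _ _ _ K (by omega) le_rfl)⟩,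
      fun i => ⟨_, hmem _ _ _ (2 * K) (by omega) le_rfl, hmem _ _ _ (2 * K) le_rfl (by omega)⟩⟩
  · exact hD _ fun j => hPS j _ _ (by omega) le_rfl
  · rw [Fin.forall_fin_two]
    refine ⟨fun i => hPS _ _ _ hK (h2K _), fun i => (hD _ fun j => ?_).symm⟩
    by_cases hij : ι i = j
    · exact hij ▸ hSS _ _ _ _ _ (by omega) le_rfl
    · exact hSS' _ _ hij _ _ _ _ (by omega) le_rfl
  · exact fun i j hij => hSS' _ _ (hι i j hij) _ _ _ _ (by omega) (h2K _)
  · exact fun i => hAS _ _ _ le_rfl (h3K _)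
  · exact fun i => hPS _ _ _ (by omega) (h3K _)
  · refine fun i => (hD _ fun j => ?_).symm
    by_cases hij : ι i = j
    · exact hij ▸ hAS _ _ _ (by omega) le_rfl
    · exact hAS' _ _ hij _ _ le_rfl
  · intro i a j hij
    fin_cases a
    · exact (hAS' _ _ (hι i j hij).symm _ _ (h2K _)).symm
    · exact hSS' _ _ (hι i j hij) _ _ _ _ (by omega) (h3K _)

/-! ### Slack of the distance to the root, and greedy covering -/

/-- `|h l - h k| + N ≤ l - k`. -/
def SlackGap (h : ℕ → ℕ) (N k l : ℕ) : Prop :=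
  h l + k + N ≤ h k + l ∧ h k + k + N ≤ h l + l

/-- Both inequalities telescope at `l`, so shortfalls accumulate and never cancel. -/
theorem SlackGap.trans {h : ℕ → ℕ} {M N k l m : ℕ} (h₁ : SlackGap h M k l)
    (h₂ : SlackGap h N l m) : SlackGap h (M + N) k m := by
  unfold SlackGap at *
  omega

theorem SlackGap.of_le {h : ℕ → ℕ} {M N k l : ℕ} (h₁ : SlackGap h N k l) (hMN : M ≤ N) :
    SlackGap h M k l := by
  unfold SlackGap at *
  omega

theorem slackGap_of_step {h : ℕ → ℕ} {n : ℕ} {κ : ℕ → ℕ}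
    (hκ : ∀ i < n, SlackGap h 1 (κ i) (κ (i + 1))) {i j : ℕ} (hij : i ≤ j) (hj : j ≤ n) :
    SlackGap h (j - i) (κ i) (κ j) := by
  induction j, hij using Nat.le_induction with
  | base => simp [SlackGap]
  | succ j hij ih => exact ((ih (by omega)).trans (hκ j (by omega))).of_le (by omega)

/-- The distance to `r` is 1-Lipschitz along a walk. Together with `SlackGap.trans`, this lets an
interval grow without losing slack. -/
theorem slackGap_zero_of_le (hG : G.Connected) {x y r : V} (P : G.Walk x y) {k l : ℕ}
    (hkl : k ≤ l) : SlackGap (fun s => G.dist (P.getVert s) r) 0 k l := by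
  have h1 := dist_getVert_getVert_le hG P hkl
  have h2 := hG.dist_triangle (u := P.getVert k) (v := P.getVert l) (w := r)
  have h3 := hG.dist_triangle (u := P.getVert l) (v := P.getVert k) (w := r)
  rw [G.dist_comm (u := P.getVert l) (v := P.getVert k)] at h3
  simp only [SlackGap]
  omega

theorem exists_walk_segment {x y : V} (P : G.Walk x y) {k l : ℕ} (hkl : k ≤ l)
    (hl : l ≤ P.length) : ∃ q : G.Walk (P.getVert k) (P.getVert l), q.length = l - k ∧
      ∀ s, k ≤ s → s ≤ l → P.getVert s ∈ q.support := by
  induction l, hkl using Nat.le_induction with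
  | base =>
    refine ⟨Walk.nil, by simp, fun s h1 h2 => ?_⟩
    obtain rfl : s = k := by omega
    simp
  | succ l hkl ih =>
    obtain ⟨q, hq, hs⟩ := ih (by omega)
    refine ⟨q.concat (P.adj_getVert_succ (by omega)), by rw [Walk.length_concat]; omega,
      fun s h1 h2 => ?_⟩
    rw [Walk.support_concat, List.mem_append]
    rcases Nat.lt_or_ge l s with h | h
    · obtain rfl : s = l + 1 := by omega
      simp
    · exact Or.inl (hs s h1 h)

/-- A segment along which the distance to `r` is strictly monotone lies on a geodesic from `r`. -/
theorem exists_rooted_of_not_slackGap (hG : G.Connected) {x y : V} (r : V) (P : G.Walk x y)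
    {k l : ℕ} (hkl : k ≤ l) (hl : l ≤ P.length)
    (h : ¬ SlackGap (fun s => G.dist (P.getVert s) r) 1 k l) :
    ∃ w : (z : V) × G.Walk r z, IsIsometric w.2 ∧
      ∀ s, k ≤ s → s ≤ l → P.getVert s ∈ w.2.support := by
  obtain ⟨q, hq, hs⟩ := exists_walk_segment P hkl hl
  obtain ⟨a, ha⟩ := hG.exists_walk_length_eq_dist r (P.getVert k)
  obtain ⟨b, hb⟩ := hG.exists_walk_length_eq_dist r (P.getVert l)
  have h1 := slackGap_zero_of_le (r := r) hG P hkl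
  simp only [SlackGap] at h h1
  simp only [G.dist_comm (v := r)] at h h1
  -- Without slack the distance to `r` changes by exactly `l - k`, so a geodesic from `r` to the
  -- nearer end extends along the segment to a geodesic.
  by_cases hup : G.dist r (P.getVert k) ≤ G.dist r (P.getVert l)
  · refine ⟨⟨_, a.append q⟩, ?_, fun s h1 h2 => ?_⟩
    · simp only [IsIsometric, Walk.length_append]
      omega
    · rw [Walk.mem_support_append_iff]
      exact Or.inr (hs s h1 h2)
  · refine ⟨⟨_, b.append q.reverse⟩, ?_, fun s h1 h2 => ?_⟩
    · simp only [IsIsometric, Walk.length_append, Walk.length_reverse]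
      omega
    · rw [Walk.mem_support_append_iff]
      exact Or.inr (by simpa using hs s h1 h2)

/-- Either the walk from its `k`-th vertex on has `n` consecutive gaps, or it can be covered
by `n` rooted isometric paths. -/
theorem exists_slackGaps_or_cover (hG : G.Connected) {x y : V} (r : V) (P : G.Walk x y) (n : ℕ) :
    ∀ k ≤ P.length, (∃ κ : ℕ → ℕ, κ 0 = k ∧ κ n ≤ P.length ∧
        ∀ i < n, SlackGap (fun s => G.dist (P.getVert s) r) 1 (κ i) (κ (i + 1))) ∨
      ∃ w : Fin n → (z : V) × G.Walk r z, (∀ i, IsIsometric (w i).2) ∧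
        ∀ s, k ≤ s → s ≤ P.length → ∃ i, P.getVert s ∈ (w i).2.support := by
  classical
  induction n with
  | zero => exact fun k hk => Or.inl ⟨fun _ => k, rfl, hk, by simp⟩
  | succ n ih =>
    intro k hk
    by_cases hex : ∃ l, l ≤ P.length ∧ SlackGap (fun s => G.dist (P.getVert s) r) 1 k l
    · obtain ⟨hl, hgap⟩ := Nat.find_spec hex
      have hmin := fun m => Nat.find_min hex (m := m)
      generalize Nat.find hex = l at hl hgap hmin
      have hkl : k < l := by unfold SlackGap at hgap; omega
      rcases ih l hl with ⟨κ, h0, hn, hκ⟩ | ⟨w, hw, hcov⟩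
      · refine Or.inl ⟨fun i => Nat.casesOn i k κ, rfl, hn, fun i hi => ?_⟩
        cases i with
        | zero => simpa [h0] using hgap
        | succ i => exact hκ i (by omega)
      -- By minimality of `l` there is no slack up to `l - 1`; the vertex at `l` opens the next
      -- piece.
      · obtain ⟨v, hv, hvs⟩ := exists_rooted_of_not_slackGap hG r P (k := k) (l := l - 1)
          (by omega) (by omega) fun h => hmin (l - 1) (by omega) ⟨by omega, h⟩
        refine Or.inr ⟨Fin.cons v w, fun i => ?_, fun s h1 h2 => ?_⟩
        · cases i using Fin.cases with
          | zero => exact hv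
          | succ i => exact hw i
        · rcases Nat.lt_or_ge s l with h | h
          · exact ⟨0, hvs s h1 (by omega)⟩
          · obtain ⟨i, hi⟩ := hcov s h h2
            exact ⟨i.succ, hi⟩
    · obtain ⟨v, hv, hvs⟩ := exists_rooted_of_not_slackGap hG r P hk le_rfl
        fun h => hex ⟨_, le_rfl, h⟩
      exact Or.inr ⟨fun _ => v, fun _ => hv, fun s h1 h2 => ⟨0, hvs s h1 h2⟩⟩

/-! ### Bounding the strong isometric path complexity -/

/-- The part of a geodesic to `r` after its last vertex close to `P`. -/
theorem exists_geodesic_leaving (hG : G.Connected) (K : ℕ) {x y a : V} (r : V) (P : G.Walk x y)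
    (ha : a ∈ P.support) : ∃ (l : ℕ) (q : V) (Q : G.Walk q r), l ≤ P.length ∧ IsIsometric Q ∧
      G.dist (P.getVert l) q ≤ K ∧ G.dist a q + G.dist q r = G.dist a r ∧
      ∀ s, 1 ≤ s → s ≤ Q.length → ∀ v ∈ P.support, K ≤ G.dist v (Q.getVert s) := by
  classical
  obtain ⟨R, hR⟩ := hG.exists_walk_length_eq_dist a r
  have hR' : IsIsometric R := hR
  let close : ℕ → Prop := fun s => ∃ v ∈ P.support, G.dist v (R.getVert s) ≤ K
  have h0 : close 0 := ⟨a, ha, by simp⟩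
  obtain ⟨v, hv, hvs⟩ : close (Nat.findGreatest close R.length) :=
    Nat.findGreatest_spec (Nat.zero_le _) h0
  have hmax : ∀ s, Nat.findGreatest close R.length < s → s ≤ R.length → ¬ close s :=
    fun s => Nat.findGreatest_is_greatest
  have hle : Nat.findGreatest close R.length ≤ R.length := Nat.findGreatest_le _
  generalize Nat.findGreatest close R.length = m at hvs hmax hle
  obtain ⟨l, rfl, hl⟩ := Walk.mem_support_iff_exists_getVert.1 hv
  have h1 := hR'.dist_getVert_getVert hG (Nat.zero_le m) hle
  have h2 := hR'.dist_getVert_getVert hG hle le_rfl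
  rw [Walk.getVert_zero] at h1
  rw [Walk.getVert_length] at h2
  have hlen : (R.drop m).length = R.length - m := by simp
  refine ⟨l, R.getVert m, R.drop m, hl, hlen.trans h2.symm, hvs, by omega, ?_⟩
  intro s hs1 hs v hv
  have h3 := hmax (m + s) (by omega) (by omega)
  rw [Walk.drop_getVert]
  by_contra! hlt
  exact h3 ⟨v, hv, hlt.le⟩

/-- The number of rooted isometric paths that suffice without a `K`-fat `K_{2,t}` minor. -/
def rootedCoverBound (K t : ℕ) : ℕ := 12 * K * (3 * (t + 2))

theorem coveredByRooted_of_not_isFatMinor_K2 (hG : G.Connected) {K t : ℕ} (hK : 1 ≤ K)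
    (hfree : ¬ IsFatMinor K (K2 t) G) (r : V) {x y : V} (P : G.Walk x y) (hP : IsIsometric P) :
    CoveredByRooted G r (rootedCoverBound K t) P := by
  rcases exists_slackGaps_or_cover hG r P (rootedCoverBound K t) 0 (Nat.zero_le _) with
    ⟨κ, -, hn, hκ⟩ | ⟨w, hw, hcov⟩
  · exfalso
    refine hfree ?_
    set h : ℕ → ℕ := fun s => G.dist (P.getVert s) r with hh
    have hmono : ∀ k l, k ≤ l → SlackGap h 0 k l := fun k l => slackGap_zero_of_le hG P
    -- The gaps are grouped into blocks of `12 * K`. The i-th geodesic starts at block boundary 3i +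
    -- 1, its window reaches one block to either side, and one more block separates consecutive
    -- windows.
    have hgap : ∀ i j, i < j → j ≤ 3 * (t + 2) →
        SlackGap h (12 * K) (κ (12 * K * i)) (κ (12 * K * j)) := fun i j hij hj => by
      refine (slackGap_of_step hκ (Nat.mul_le_mul_left _ hij.le)
        (Nat.mul_le_mul_left _ hj)).of_le ?_
      rw [← Nat.mul_sub]
      exact Nat.le_mul_of_pos_right _ (by omega)
    have hleaf := fun i : Fin (t + 2) => exists_geodesic_leaving hG K r P
      (P.getVert_mem_support (κ (12 * K * (3 * i + 1))))
    choose l q Q hl hQ hlq hq hfar using hleaf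
    have hκL : ∀ i ≤ 3 * (t + 2), κ (12 * K * i) ≤ P.length := fun i hi => by
      have := slackGap_of_step hκ (Nat.mul_le_mul_left (12 * K) hi) le_rfl
      unfold SlackGap at this
      unfold rootedCoverBound at hn
      omega
    have hdist : ∀ k m, k ≤ m → m ≤ P.length → G.dist (P.getVert k) (P.getVert m) = m - k :=
      fun k m => hP.dist_getVert_getVert hG
    have hql : ∀ i, G.dist (q i) r ≤ h (l i) + K ∧ h (l i) ≤ G.dist (q i) r + K := fun i => by
      have h1 := hG.dist_triangle (u := P.getVert (l i)) (v := q i) (w := r)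
      have h2 := hG.dist_triangle (u := q i) (v := P.getVert (l i)) (w := r)
      rw [G.dist_comm (u := q i) (v := P.getVert (l i))] at h2
      have h3 := hlq i
      simp only [hh]
      omega
    -- Through `q i`, the distance from the starting vertex to `P.getVert (l i)` exceeds the drop in
    -- `h` by at most 2K. Outside the window a full block lies in between and forces an excess of
    -- 12K.
    have hwindow : ∀ i : Fin (t + 2), κ (12 * K * (3 * i)) ≤ l i ∧
        l i ≤ κ (12 * K * (3 * i + 2)) := by
      intro i
      have h1 := hgap (3 * i) (3 * i + 1) (by omega) (by omega)
      have h2 := hgap (3 * i + 1) (3 * i + 2) (by omega) (by omega)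
      have h3 := hκL (3 * i + 1) (by omega)
      have h4 := hG.dist_triangle (u := P.getVert (κ (12 * K * (3 * i + 1)))) (v := q i)
        (w := P.getVert (l i))
      rw [G.dist_comm (u := q i)] at h4
      have h5 := hlq i
      have h6 := hq i
      have h7 := hql i
      have h8 : G.dist (P.getVert (κ (12 * K * (3 * i + 1)))) r =
        h (κ (12 * K * (3 * i + 1))) := rfl
      have h9 := hl i
      generalize κ (12 * K * (3 * i)) = k₀ at *
      generalize κ (12 * K * (3 * i + 1)) = k₁ at *
      generalize κ (12 * K * (3 * i + 2)) = k₂ at *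
      refine ⟨?_, ?_⟩ <;> by_contra! hlt
      · have h10 := ((hmono _ _ hlt.le).trans h1)
        have h11 := hdist (l i) k₁ (by unfold SlackGap at h10; omega) h3
        rw [G.dist_comm] at h11
        unfold SlackGap at h10
        omega
      · have h10 := (h2.trans (hmono _ _ hlt.le))
        have h11 := hdist k₁ (l i) (by unfold SlackGap at h10; omega) h9
        unfold SlackGap at h10
        omega
    have hll : ∀ i j : Fin (t + 2), i < j → SlackGap h (12 * K) (l i) (l j) := fun i j hij => by
      have hij' : (i : ℕ) < j := hij
      exact (((hmono _ _ (hwindow i).2).trans (hgap (3 * i + 2) (3 * j) (by omega)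
        (by omega))).trans (hmono _ _ (hwindow j).1)).of_le (by omega)
    -- Replacing the vertices of `P` by `q i` and `q j` costs 2K in their mutual distance and 2K in
    -- the difference of their distances to `r`, so 8K of the 12K remain.
    have hqq : ∀ i j : Fin (t + 2), i < j →
        G.dist (q i) r + 8 * K ≤ G.dist (q j) r + G.dist (q i) (q j) ∧
        G.dist (q j) r + 8 * K ≤ G.dist (q i) r + G.dist (q i) (q j) := fun i j hij => by
      have h1 := hll i j hij
      unfold SlackGap at h1
      have h2 := hdist (l i) (l j) (by omega) (hl j)
      have h3 := hG.dist_triangle (u := P.getVert (l i)) (v := q i) (w := P.getVert (l j))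
      have h4 := hG.dist_triangle (u := q i) (v := q j) (w := P.getVert (l j))
      rw [G.dist_comm (u := q j)] at h4
      have h5 := hlq i
      have h6 := hlq j
      have h7 := hql i
      have h8 := hql j
      omega
    refine isFatMinor_K2_of_geodesics hG hK P (fun i => P.getVert (l i)) q
      (fun i => P.getVert_mem_support _) hlq Q hQ hfar fun i j hij => ?_
    rcases lt_or_gt_of_ne hij with hlt | hlt
    · exact (hqq i j hlt).1
    · rw [G.dist_comm (u := q i) (v := q j)]
      exact (hqq j i hlt).2
  · refine ⟨fun i => (w i).1, fun i => (w i).2, hw, fun a ha => ?_⟩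
    obtain ⟨s, rfl, hs⟩ := Walk.mem_support_iff_exists_getVert.1 ha
    exact hcov s (Nat.zero_le _) hs

theorem strongIsometricPathComplexity_le (hG : G.Connected) {K t : ℕ} (hK : 1 ≤ K)
    (hfree : ¬ IsFatMinor K (K2 t) G) :
    strongIsometricPathComplexity G ≤ (rootedCoverBound K t : ℕ∞) :=
  iInf₂_le _ fun r _ _ P hP => coveredByRooted_of_not_isFatMinor_K2 hG hK hfree r P hP

end CoarseGraph

theorem mainTheorem7 :
    (∃ f : ℕ → ℕ → ℕ, ∀ K t : ℕ, 1 ≤ K →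
      ∀ (V : Type u) [Finite V] (G : SimpleGraph V), G.Connected →
        ¬ CoarseGraph.IsFatMinor K (CoarseGraph.K2 t) G →
        CoarseGraph.strongIsometricPathComplexity G ≤ (f K t : ℕ∞)) ∧
    (∀ K t : ℕ, 1 ≤ K → 1 ≤ t → ∀ (V : Type u) [Finite V] (G : SimpleGraph V),
      CoarseGraph.IsFatMinor K (CoarseGraph.fan t) G →
        CoarseGraph.IsFatMinor (K / 4) (CoarseGraph.K2 t) G) ∧
    (∀ t : ℕ, 1 ≤ t → ∀ 𝒢 : Set CoarseGraph.FiniteGraph.{u},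
      CoarseGraph.AsymptoticMinorFree 𝒢 (CoarseGraph.K2 t) →
        CoarseGraph.AsymptoticMinorFree 𝒢 (CoarseGraph.fan t)) :=
  ⟨⟨CoarseGraph.rootedCoverBound, fun _ _ hK _ _ _ hG hfree =>
      CoarseGraph.strongIsometricPathComplexity_le hG hK hfree⟩,
    fun _ _ _ ht _ _ _ h => CoarseGraph.isFatMinor_K2_of_fan ht h,
    fun _ ht _ h => CoarseGraph.asymptoticMinorFree_fan ht h⟩
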